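/- Let $\Omega_n=\{0,1\}^n$ carry the coordinatewise order and the uniform probability measure $\mu$; write $\mathbb E$ for the expectation with respect to $\mu$, and $x\oplus e_k$ for $x$ with its $k$-th coordinate flipped. A family $\mathcal A\subset\Omega_n$ is *increasing* if $x\in\mathcal A$ and $x\le y$ imply $y\in\mathcal A$. For $\mathcal A,\mathcal B\subset\Omega_n$ put $$\mathrm{Cov}(\mathcal A,\mathcal B)=\mu(\mathcal A\cap\mathcal B)-\mu(\mathcal A)\mu(\mathcal B),\quad I_k(\mathcal A)=2\mu(\{x\in\mathcal A: x\oplus e_k\notin\mathcal A\}),\quad I(\mathcal A)=\sum_{k=1}^n I_k(\mathcal A),\quad W_1(\mathcal A,\mathcal B)=\sum_{i=1}^n I_i(\mathcal A)I_i(\mathcal B).$$ For $f,g:\Omega_n\to[-1,1]$ put $$\mathrm{Cov}(f,g)=\mathbb E[fg]-\mathbb E[f]\,\mathbb E[g],\quad I_k(f)=\mathbb E\,|f(x)-f(x\oplus e_k)|,\quad I(f)=\sum_{k=1}^n I_k(f),\quad W_1(f,g)=\sum_{i=1}^n\hat f(\{i\})\,\hat g(\{i\}),$$ where $\hat f(\{i\})=\mathbb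 E[f(x)(-1)^{x_i}]$ is the level-one Fourier–Walsh coefficient (so $W_1(f,g)=\frac14\sum_i I_i(f)I_i(g)$ if $f,g$ are increasing). Let $F,G$ be two increasing families, or two increasing functions into $[-1,1]$. They are *similar* if all ratios $I_i(F)/I_i(G)$ are equal, that is, $I_i(F)I_j(G)=I_j(F)I_i(G)$ for all $i,j$. They are *weakly similar with constant* $c'>0$ if $\max_i I_i(F)/I_i(G)\le c'\min_i I_i(F)/I_i(G)$, that is, $I_i(F)I_j(G)\le c'\,I_j(F)I_i(G)$ for all $i,j$. A family or function is *regular* if all its influences $I_i$ are equal. In the bounds below the right-hand side is read as $0$ if the numerator is $0$ (in particular if all influences of $F$ or all influences of $G$ vanish). **Theorem.** There is a universal constant $c>0$ such that the following hold for every $n$. 1. If $\mathcal A,\mathcal B\subset\Omega_n$ are increasing and similar, then $$\mathrm{Cov}(\mathcal A,\mathcal B)\ \ge\ c\,\frac{W_1(\mathcal A,\mathcal B)}{\sqrt{\log\frac{e}{W_1(\mathcal A,\mathcal A)}}\,\sqrt{\log\frac{e}{W_1(\mathcal B,\mathcal B)}}}.$$ 2. In particular, if $\mathcal A,\mathcal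 B\subset\Omega_n$ are increasing and regular, then $$\mathrm{Cov}(\mathcal A,\mathcal B)\ \ge\ c\sum_{i=1}^n\frac{I_i(\mathcal A)}{\sqrt{\log\frac{e}{nI_i(\mathcal A)^2}}}\cdot\frac{I_i(\mathcal B)}{\sqrt{\log\frac{e}{nI_i(\mathcal B)^2}}}\ =\ c\,\frac{I(\mathcal A)I(\mathcal B)}{n\sqrt{\log\frac{en}{I(\mathcal A)^2}}\,\sqrt{\log\frac{en}{I(\mathcal B)^2}}}.$$ 3. If $f,g:\Omega_n\to[-1,1]$ are increasing and similar, then $$\mathrm{Cov}(f,g)\ \ge\ c\,\frac{W_1(f,g)}{\sqrt{\log\frac{e}{W_1(f,f)}}\,\sqrt{\log\frac{e}{W_1(g,g)}}};$$ if $f,g:\Omega_n\to[-1,1]$ are increasing and regular, then $$\mathrm{Cov}(f,g)\ \ge\ c\,\frac{I(f)I(g)}{n\sqrt{\log\frac{4en}{I(f)^2}}\,\sqrt{\log\frac{4en}{I(g)^2}}}.$$ Moreover, for every $c'>0$ there is a constant $c>0$ depending only on $c'$ such that, for every $n$, the inequality in 1 holds for all increasing families $\mathcal A,\mathcal B\subset\Omega_n$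 that are weakly similar with constant $c'$, and the first inequality in 3 holds for all increasing $f,g:\Omega_n\to[-1,1]$ that are weakly similar with constant $c'$. -/

import Mathlib

namespace CubeCorrelation

/-- The discrete cube `{0,1}^n`, with its coordinatewise order. -/
abbrev Cube (n : ℕ) : Type := Fin n → Bool

/-- `x ⊕ e_k`: the point `x` with its `k`-th coordinate flipped. -/
def flipAt {n : ℕ} (k : Fin n) (x : Cube n) : Cube n := Function.update x k (!(x k))

/-! ### Families of subsets -/

/-- The uniform probability measure `μ` on the cube. -/
noncomputable def mu {n : ℕ} (A : Set (Cube n)) : ℝ := (A.ncard : ℝ) / 2 ^ n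

/-- `Cov(A,B) = μ(A ∩ B) - μ(A) μ(B)`. -/
noncomputable def famCov {n : ℕ} (A B : Set (Cube n)) : ℝ := mu (A ∩ B) - mu A * mu B

/-- `I_k(A) = 2 μ({x ∈ A | x ⊕ e_k ∉ A})`. -/
noncomputable def famInfluence {n : ℕ} (A : Set (Cube n)) (k : Fin n) : ℝ :=
  2 * mu {x | x ∈ A ∧ flipAt k x ∉ A}

/-- `I(A) = ∑_k I_k(A)`. -/
noncomputable def famTotalInfluence {n : ℕ} (A : Set (Cube n)) : ℝ := ∑ k, famInfluence A k

/-- `W_1(A,B) = ∑_i I_i(A) I_i(B)`. -/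
noncomputable def famW1 {n : ℕ} (A B : Set (Cube n)) : ℝ :=
  ∑ i, famInfluence A i * famInfluence B i

/-! ### Real functions -/

/-- Expectation with respect to the uniform measure. -/
noncomputable def expect {n : ℕ} (f : Cube n → ℝ) : ℝ := (∑ x, f x) / 2 ^ n

/-- `Cov(f,g) = E[fg] - E[f] E[g]`. -/
noncomputable def funCov {n : ℕ} (f g : Cube n → ℝ) : ℝ :=
  expect (fun x => f x * g x) - expect f * expect g

/-- `I_k(f) = E[|f(x) - f(x ⊕ e_k)|]`. -/
noncomputable def funInfluence {n : ℕ} (f : Cube n → ℝ) (k : Fin n) : ℝ :=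
  expect (fun x => |f x - f (flipAt k x)|)

/-- `I(f) = ∑_k I_k(f)`. -/
noncomputable def funTotalInfluence {n : ℕ} (f : Cube n → ℝ) : ℝ := ∑ k, funInfluence f k

/-- The Walsh function `u_S(T) = (-1)^{|S ∩ T|}`, where `T = {i | x i = 1}`. -/
def walsh {n : ℕ} (S : Finset (Fin n)) (x : Cube n) : ℝ :=
  (-1) ^ (S.filter (fun i => x i = true)).card

/-- The Fourier-Walsh coefficient `⟨f, u_S⟩`. -/
noncomputable def fourierCoeff {n : ℕ} (f : Cube n → ℝ) (S : Finset (Fin n)) : ℝ :=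
  expect (fun x => f x * walsh S x)

/-- `W_d(f,g)`, the sum over all `|S| = d` of the products of the Fourier-Walsh coefficients
of `f` and `g` at `S`. -/
noncomputable def funW {n : ℕ} (d : ℕ) (f g : Cube n → ℝ) : ℝ :=
  ∑ S ∈ Finset.powersetCard d Finset.univ, fourierCoeff f S * fourierCoeff g S

/-! ### Similarity and regularity, in terms of the vectors of influences -/

/-- All ratios `a i / b i` are equal. The condition is cross-multiplied, so that a coordinate with
`a i = b i = 0` is no restriction, while a ratio `a i / 0` with `a i ≠ 0` counts as infinite. -/
def EqualRatios {n : ℕ} (a b : Fin n → ℝ) : Prop :=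
  ∀ i j, a i * b j = a j * b i

/-- `max (a i / b i) ≤ K * min (a i / b i)`, for nonnegative `a`, `b`; cross-multiplied as in
`EqualRatios`. -/
def WeaklyEqualRatios {n : ℕ} (K : ℝ) (a b : Fin n → ℝ) : Prop :=
  ∀ i j, a i * b j ≤ K * (a j * b i)

/-- `A` and `B` are similar. -/
def FamSimilar {n : ℕ} (A B : Set (Cube n)) : Prop :=
  EqualRatios (famInfluence A) (famInfluence B)

/-- `A` and `B` are weakly similar with constant `K`. -/
def FamWeaklySimilar {n : ℕ} (K : ℝ) (A B : Set (Cube n)) : Prop :=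
  WeaklyEqualRatios K (famInfluence A) (famInfluence B)

/-- `A` is regular: all its influences are equal. -/
def FamRegular {n : ℕ} (A : Set (Cube n)) : Prop :=
  ∀ i j, famInfluence A i = famInfluence A j

/-- `f` and `g` are similar. -/
def FunSimilar {n : ℕ} (f g : Cube n → ℝ) : Prop :=
  EqualRatios (funInfluence f) (funInfluence g)

/-- `f` and `g` are weakly similar with constant `K`. -/
def FunWeaklySimilar {n : ℕ} (K : ℝ) (f g : Cube n → ℝ) : Prop :=
  WeaklyEqualRatios K (funInfluence f) (funInfluence g)

/-- `f` is regular: all its influences are equal. -/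
def FunRegular {n : ℕ} (f : Cube n → ℝ) : Prop :=
  ∀ i j, funInfluence f i = funInfluence f j

/-- `f` is increasing with values in `[-1,1]`. -/
def IncreasingBounded {n : ℕ} (f : Cube n → ℝ) : Prop :=
  Monotone f ∧ ∀ x, f x ∈ Set.Icc (-1 : ℝ) 1

/-! ### The right-hand side -/

/-- `w / (√log(e/u) √log(e/v))`. It is used with `w = W_1(A,B)`, `u = W_1(A,A)` and `v = W_1(B,B)`,
where `u, v ∈ [0,1]`, so that the logarithms are at least `1` unless `u` or `v` is `0`; in that
case `w = 0` and the quotient is `0`. -/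
noncomputable def corrBound (w u v : ℝ) : ℝ :=
  w / (√(Real.log (Real.exp 1 / u)) * √(Real.log (Real.exp 1 / v)))

end CubeCorrelation

open CubeCorrelation

/-!
Let `T_ρ` be the noise operator. The function `ρ ↦ E[T_ρ f · g]` goes from `E f · E g` at `ρ = 0`
to `E[f g]` at `ρ = 1`, and its derivative `∑ᵢ E[T_ρ ∂ᵢf · ∂ᵢg]` is nonnegative for increasing `f`
and `g`. Hence `Cov(f, g)` is at least its growth on `[0, R]`, for any `R ≤ 1`. At `ρ = 0` the
derivative is `W₁(f, g)`, and by the Cauchy–Schwarz inequality it stays above half of this value as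
long as the total variances of the noisy gradients of `f` and `g` are `O(W₁(f, f))` and
`O(W₁(g, g))`, which `W₁(f, g)` controls by similarity.

To bound such a variance, write the noisy `∂ᵢf` as `T_r h` with `h = T_{1/√2} ∂ᵢf ≥ 0`. For
`r² = 1 / (2m + 1)`, hypercontractivity from `L²` to `L^{2(m + 1)}` bounds `Var(T_r h)` by a
multiple of `(E h)²` plus `e^{-2m} E[h²]`. The first terms add up to a multiple of `W₁(f, f)`. The
sum over `i` of the `E[h²]` is at most `2`, by Bessel's inequality for the product measure that
defines `T_{1/√2}`. Taking `m ≈ log(1 / W₁(f, f)) / 2` makes both contributions comparable and gives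
the noise strength `r² ≈ 1 / log(e / W₁(f, f))`.
-/

namespace CubeCorrelation

open Finset

variable {n m : ℕ}

/-! ### Expectation and Fourier–Walsh expansion -/

/-- The sign `(-1)^b`, so that `x ↦ sgn (x i)` is the Walsh function of `{i}`. -/
def sgn (b : Bool) : ℝ := if b then -1 else 1

@[simp] lemma sgn_true : sgn true = -1 := rfl

@[simp] lemma sgn_false : sgn false = 1 := rfl

lemma sgn_not (b : Bool) : sgn (!b) = -sgn b := by cases b <;> simp

lemma sgn_mul_self (b : Bool) : sgn b * sgn b = 1 := by cases b <;> simp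

lemma walsh_eq_prod (S : Finset (Fin n)) (x : Cube n) : walsh S x = ∏ i ∈ S, sgn (x i) := by
  simp [walsh, sgn, prod_ite]

@[simp] lemma walsh_empty (x : Cube n) : walsh ∅ x = 1 := by simp [walsh]

lemma walsh_insert {i : Fin n} {S : Finset (Fin n)} (h : i ∉ S) (x : Cube n) :
    walsh (insert i S) x = sgn (x i) * walsh S x := by
  rw [walsh_eq_prod, walsh_eq_prod, prod_insert h]

lemma expect_add (f g : Cube n → ℝ) : expect (fun x => f x + g x) = expect f + expect g := by
  simp [expect, sum_add_distrib, add_div]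

lemma expect_sub (f g : Cube n → ℝ) : expect (fun x => f x - g x) = expect f - expect g := by
  simp [expect, sum_sub_distrib, sub_div]

lemma expect_const_mul (c : ℝ) (f : Cube n → ℝ) : expect (fun x => c * f x) = c * expect f := by
  simp [expect, ← mul_sum, mul_div_assoc]

lemma expect_sum {ι : Type*} (s : Finset ι) (f : ι → Cube n → ℝ) :
    expect (fun x => ∑ i ∈ s, f i x) = ∑ i ∈ s, expect (f i) := by
  simp only [expect]
  rw [sum_comm, sum_div]

@[simp] lemma expect_const (c : ℝ) : expect (fun _ : Cube n => c) = c := by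
  simp [expect]

lemma expect_mono {f g : Cube n → ℝ} (h : ∀ x, f x ≤ g x) : expect f ≤ expect g := by
  unfold expect
  gcongr with x
  exact h x

lemma expect_nonneg {f : Cube n → ℝ} (h : ∀ x, 0 ≤ f x) : 0 ≤ expect f :=
  div_nonneg (sum_nonneg fun x _ => h x) (by positivity)

lemma expect_prod (φ : Fin n → Bool → ℝ) :
    expect (fun x => ∏ i, φ i (x i)) = ∏ i, (φ i true + φ i false) / 2 := by
  have h := prod_univ_sum (fun _ : Fin n => (univ : Finset Bool)) φ
  rw [Fintype.piFinset_univ] at h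
  rw [expect, ← h, prod_div_distrib]
  simp

lemma expect_walsh_mul_walsh (S U : Finset (Fin n)) :
    expect (fun x => walsh S x * walsh U x) = if S = U then 1 else 0 := by
  have hprod : ∀ x : Cube n, walsh S x * walsh U x =
      ∏ i, ((if i ∈ S then sgn (x i) else 1) * (if i ∈ U then sgn (x i) else 1)) := by
    intro x
    rw [prod_mul_distrib, walsh_eq_prod, walsh_eq_prod]
    simp only [prod_ite_mem, univ_inter]
  simp_rw [hprod]
  rw [expect_prod (fun i b => (if i ∈ S then sgn b else 1) * (if i ∈ U then sgn b else 1))]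
  split_ifs with hSU
  · subst hSU
    refine prod_eq_one fun i _ => ?_
    split_ifs <;> norm_num
  · obtain ⟨i, hi⟩ : ∃ i, ¬ (i ∈ S ↔ i ∈ U) := by
      by_contra! hc
      exact hSU (Finset.ext hc)
    refine prod_eq_zero (mem_univ i) ?_
    by_cases hS : i ∈ S <;> by_cases hU : i ∈ U <;> simp_all

lemma fourierCoeff_empty (f : Cube n → ℝ) : fourierCoeff f ∅ = expect f := by
  simp [fourierCoeff]

/-! ### The noise operator -/

/-- The density, with respect to the uniform measure, of the point `y` obtained from `x` by
resampling each coordinate independently with probability `1 - ρ`. -/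
def noiseKernel (ρ : ℝ) (x y : Cube n) : ℝ := ∏ i, (1 + ρ * (sgn (x i) * sgn (y i)))

/-- The noise operator `T_ρ`, which multiplies the Fourier–Walsh coefficient at `S` by `ρ^|S|`. -/
noncomputable def noise (ρ : ℝ) (f : Cube n → ℝ) (x : Cube n) : ℝ :=
  expect (fun y => f y * noiseKernel ρ x y)

lemma noiseKernel_nonneg {ρ : ℝ} (h0 : 0 ≤ ρ) (h1 : ρ ≤ 1) (x y : Cube n) :
    0 ≤ noiseKernel ρ x y := by
  refine prod_nonneg fun i _ => ?_
  cases x i <;> cases y i <;> simp <;> linarith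

lemma noise_nonneg {ρ : ℝ} (h0 : 0 ≤ ρ) (h1 : ρ ≤ 1) {f : Cube n → ℝ} (hf : ∀ x, 0 ≤ f x)
    (x : Cube n) : 0 ≤ noise ρ f x :=
  expect_nonneg fun y => mul_nonneg (hf y) (noiseKernel_nonneg h0 h1 x y)

lemma noise_add (ρ : ℝ) (f g : Cube n → ℝ) (x : Cube n) :
    noise ρ (fun y => f y + g y) x = noise ρ f x + noise ρ g x := by
  simp only [noise, add_mul, expect_add]

lemma noise_sub (ρ : ℝ) (f g : Cube n → ℝ) (x : Cube n) :
    noise ρ (fun y => f y - g y) x = noise ρ f x - noise ρ g x := by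
  simp only [noise, sub_mul, expect_sub]

lemma noise_const_mul (ρ c : ℝ) (f : Cube n → ℝ) (x : Cube n) :
    noise ρ (fun y => c * f y) x = c * noise ρ f x := by
  simp only [noise, mul_assoc, expect_const_mul]

lemma noise_sum {ι : Type*} (ρ : ℝ) (s : Finset ι) (f : ι → Cube n → ℝ) (x : Cube n) :
    noise ρ (fun y => ∑ i ∈ s, f i y) x = ∑ i ∈ s, noise ρ (f i) x := by
  simp only [noise, sum_mul, expect_sum]

lemma noise_const (ρ c : ℝ) (x : Cube n) : noise ρ (fun _ => c) x = c := by
  rw [noise, expect_const_mul]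
  unfold noiseKernel
  rw [expect_prod fun i b => 1 + ρ * (sgn (x i) * sgn b), prod_eq_one fun i _ => ?_, mul_one]
  simp only [sgn_true, sgn_false]
  ring

lemma noise_zero (f : Cube n → ℝ) (x : Cube n) : noise 0 f x = expect f := by
  simp [noise, noiseKernel]

lemma noise_one (f : Cube n → ℝ) (x : Cube n) : noise 1 f x = f x := by
  have hdiag : noiseKernel 1 x x = 2 ^ n := by
    simp only [noiseKernel, sgn_mul_self, prod_const, card_univ, Fintype.card_fin]
    norm_num
  rw [noise, expect, sum_eq_single x]
  · rw [hdiag]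
    field_simp
  · intro y _ hy
    obtain ⟨i, hi⟩ := Function.ne_iff.mp hy
    rw [noiseKernel, prod_eq_zero (mem_univ i), mul_zero]
    revert hi
    cases x i <;> cases y i <;> simp
  · simp

lemma noiseKernel_eq_sum (ρ : ℝ) (x y : Cube n) :
    noiseKernel ρ x y = ∑ S : Finset (Fin n), ρ ^ #S * walsh S x * walsh S y := by
  rw [noiseKernel, prod_one_add, powerset_univ]
  refine sum_congr rfl fun S _ => ?_
  rw [prod_mul_distrib, prod_mul_distrib, prod_const, walsh_eq_prod, walsh_eq_prod, mul_assoc]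

lemma noise_eq_sum (ρ : ℝ) (f : Cube n → ℝ) (x : Cube n) :
    noise ρ f x = ∑ S : Finset (Fin n), ρ ^ #S * fourierCoeff f S * walsh S x := by
  simp only [noise, noiseKernel_eq_sum, mul_sum, expect_sum]
  refine sum_congr rfl fun S _ => ?_
  rw [fourierCoeff, mul_right_comm, ← expect_const_mul]
  congr 1
  ext y
  ring

lemma fourierCoeff_noise (ρ : ℝ) (f : Cube n → ℝ) (S : Finset (Fin n)) :
    fourierCoeff (noise ρ f) S = ρ ^ #S * fourierCoeff f S := by
  rw [fourierCoeff]
  simp only [noise_eq_sum, sum_mul, expect_sum, mul_assoc, expect_const_mul,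
    expect_walsh_mul_walsh]
  simp

lemma noise_noise (ρ σ : ℝ) (f : Cube n → ℝ) : noise ρ (noise σ f) = noise (ρ * σ) f := by
  ext x
  rw [noise_eq_sum, noise_eq_sum]
  simp only [fourierCoeff_noise, mul_pow, mul_assoc]

lemma expect_noise (ρ : ℝ) (f : Cube n → ℝ) : expect (noise ρ f) = expect f := by
  rw [← fourierCoeff_empty, fourierCoeff_noise, card_empty, pow_zero, one_mul, fourierCoeff_empty]

/-- The correlation `E[T_ρ f · g]` of `g` with a noisy version of `f`. -/
noncomputable def noiseCorr (f g : Cube n → ℝ) (ρ : ℝ) : ℝ := expect (fun x => noise ρ f x * g x)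

lemma noiseCorr_zero (f g : Cube n → ℝ) : noiseCorr f g 0 = expect f * expect g := by
  simp only [noiseCorr, noise_zero, expect_const_mul]

lemma noiseCorr_one (f g : Cube n → ℝ) : noiseCorr f g 1 = expect (fun x => f x * g x) := by
  simp only [noiseCorr, noise_one]

lemma noiseCorr_eq_sum (f g : Cube n → ℝ) (ρ : ℝ) :
    noiseCorr f g ρ =
      ∑ S : Finset (Fin n), ρ ^ #S * (fourierCoeff f S * fourierCoeff g S) := by
  simp only [noiseCorr, noise_eq_sum, sum_mul, expect_sum]
  refine sum_congr rfl fun S _ => ?_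
  rw [fourierCoeff.eq_1 g, ← mul_assoc, ← expect_const_mul]
  congr 1
  ext x
  ring

lemma noiseCorr_eq_expect_mul_expect_add (f g : Cube n → ℝ) (ρ : ℝ) :
    noiseCorr f g ρ = expect f * expect g +
      ∑ S ∈ univ.erase ∅, ρ ^ #S * (fourierCoeff f S * fourierCoeff g S) := by
  rw [noiseCorr_eq_sum, ← add_sum_erase univ _ (mem_univ ∅), card_empty, pow_zero, one_mul,
    fourierCoeff_empty, fourierCoeff_empty]

lemma funCov_eq_noiseCorr_sub (f g : Cube n → ℝ) :
    funCov f g = noiseCorr f g 1 - noiseCorr f g 0 := by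
  rw [noiseCorr_one, noiseCorr_zero, funCov]

lemma funCov_eq_sum (f g : Cube n → ℝ) :
    funCov f g = ∑ S ∈ univ.erase ∅, fourierCoeff f S * fourierCoeff g S := by
  rw [funCov_eq_noiseCorr_sub, noiseCorr_zero, noiseCorr_eq_expect_mul_expect_add,
    add_sub_cancel_left]
  simp only [one_pow, one_mul]

lemma funCov_self_eq_expect_sub_sq (f : Cube n → ℝ) :
    funCov f f = expect (fun x => (f x - expect f) ^ 2) := by
  have hexpand : (fun x => (f x - expect f) ^ 2) = fun x =>
      f x * f x - 2 * expect f * f x + expect f ^ 2 := by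
    ext x
    ring
  rw [hexpand, expect_add, expect_sub, expect_const_mul, expect_const, funCov]
  ring

lemma funCov_noise_left (ρ : ℝ) (f g : Cube n → ℝ) :
    funCov (noise ρ f) g = funCov f (noise ρ g) := by
  simp only [funCov_eq_sum, fourierCoeff_noise, mul_left_comm, mul_assoc]

/-! ### Discrete derivatives -/

lemma flipAt_flipAt (k : Fin n) (x : Cube n) : flipAt k (flipAt k x) = x := by
  simp [flipAt]

lemma flipAt_same (k : Fin n) (x : Cube n) : flipAt k x k = !(x k) := by
  simp [flipAt]

lemma flipAt_of_ne {i k : Fin n} (h : i ≠ k) (x : Cube n) : flipAt k x i = x i := by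
  simp [flipAt, h]

lemma walsh_flipAt_of_notMem {i : Fin n} {S : Finset (Fin n)} (h : i ∉ S) (x : Cube n) :
    walsh S (flipAt i x) = walsh S x := by
  rw [walsh_eq_prod, walsh_eq_prod]
  exact prod_congr rfl fun j hj => by rw [flipAt_of_ne (ne_of_mem_of_not_mem hj h)]

lemma expect_flipAt (k : Fin n) (f : Cube n → ℝ) :
    expect (fun x => f (flipAt k x)) = expect f := by
  unfold expect
  congr 1
  exact Equiv.sum_comp (Function.Involutive.toPerm (flipAt k) (flipAt_flipAt k)) f

lemma expect_mul_sgn_eq_zero (i : Fin n) (g : Cube n → ℝ) (hg : ∀ x, g (flipAt i x) = g x) :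
    expect (fun x => g x * sgn (x i)) = 0 := by
  have hflip := expect_flipAt i (fun x => g x * sgn (x i))
  simp only [flipAt_same, sgn_not, hg, mul_neg] at hflip
  have hneg := expect_const_mul (-1) (fun x : Cube n => g x * sgn (x i))
  simp only [neg_mul, one_mul] at hneg
  linarith

/-- The discrete derivative `∂_i f`, normalized so that `E[∂_i f] = I_i(f) / 2` for increasing
`f`. -/
noncomputable def derivAt (i : Fin n) (f : Cube n → ℝ) (x : Cube n) : ℝ :=
  (f (Function.update x i true) - f (Function.update x i false)) / 2

lemma derivAt_eq_neg_sgn_mul (i : Fin n) (f : Cube n → ℝ) (x : Cube n) :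
    derivAt i f x = -(sgn (x i) * (f x - f (flipAt i x)) / 2) := by
  have hself := Function.update_eq_self i x
  unfold derivAt flipAt
  cases hx : x i <;> rw [hx] at hself <;> simp [hself] <;> ring

lemma derivAt_flipAt (i : Fin n) (f : Cube n → ℝ) (x : Cube n) :
    derivAt i f (flipAt i x) = derivAt i f x := by
  simp [derivAt, flipAt]

lemma derivAt_nonneg {f : Cube n → ℝ} (hf : Monotone f) (i : Fin n) (x : Cube n) :
    0 ≤ derivAt i f x :=
  div_nonneg (sub_nonneg.2 (hf (Function.update_mono (Bool.false_le _)))) zero_le_two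

lemma abs_derivAt (i : Fin n) (f : Cube n → ℝ) (x : Cube n) :
    |derivAt i f x| = |f x - f (flipAt i x)| / 2 := by
  have hsgn : |sgn (x i)| = 1 := by cases x i <;> simp
  simp [derivAt_eq_neg_sgn_mul, abs_mul, abs_div, hsgn]

lemma expect_derivAt_mul (i : Fin n) (f g : Cube n → ℝ) (hg : ∀ x, g (flipAt i x) = g x) :
    expect (fun x => derivAt i f x * g x) = -expect (fun x => f x * (sgn (x i) * g x)) := by
  have hflip := expect_flipAt i (fun x => f x * (sgn (x i) * g x))
  simp only [flipAt_same, sgn_not, hg] at hflip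
  have hsplit : (fun x => derivAt i f x * g x) = fun x =>
      (-1 / 2) * (f x * (sgn (x i) * g x)) +
        (-1 / 2) * (f (flipAt i x) * (-sgn (x i) * g x)) := by
    ext x
    rw [derivAt_eq_neg_sgn_mul]
    ring
  rw [hsplit, expect_add, expect_const_mul, expect_const_mul, hflip]
  ring

lemma fourierCoeff_derivAt_of_notMem {i : Fin n} {S : Finset (Fin n)} (h : i ∉ S)
    (f : Cube n → ℝ) : fourierCoeff (derivAt i f) S = -fourierCoeff f (insert i S) := by
  simp only [fourierCoeff, walsh_insert h]
  exact expect_derivAt_mul i f _ (walsh_flipAt_of_notMem h)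

lemma fourierCoeff_derivAt_of_mem {i : Fin n} {S : Finset (Fin n)} (h : i ∈ S)
    (f : Cube n → ℝ) : fourierCoeff (derivAt i f) S = 0 := by
  have hwalsh : ∀ x : Cube n, derivAt i f x * walsh S x =
      derivAt i f x * walsh (S.erase i) x * sgn (x i) := by
    intro x
    conv_lhs => rw [← insert_erase h, walsh_insert (notMem_erase i S)]
    ring
  simp only [fourierCoeff, hwalsh]
  refine expect_mul_sgn_eq_zero i _ fun x => ?_
  rw [derivAt_flipAt, walsh_flipAt_of_notMem (notMem_erase i S)]

lemma expect_derivAt (i : Fin n) (f : Cube n → ℝ) :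
    expect (derivAt i f) = -fourierCoeff f {i} := by
  rw [← fourierCoeff_empty, fourierCoeff_derivAt_of_notMem (notMem_empty i), insert_empty]

lemma funW_one_eq_sum (f g : Cube n → ℝ) :
    funW 1 f g = ∑ i, expect (derivAt i f) * expect (derivAt i g) := by
  simp [funW, powersetCard_one, expect_derivAt]

lemma funW_one_self_eq_sum_sq (f : Cube n → ℝ) :
    funW 1 f f = ∑ i, expect (derivAt i f) ^ 2 := by
  simp only [funW_one_eq_sum, sq]

lemma funW_one_self_nonneg (f : Cube n → ℝ) : 0 ≤ funW 1 f f := by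
  rw [funW_one_self_eq_sum_sq]
  positivity

lemma expect_derivAt_eq_funInfluence {f : Cube n → ℝ} (hf : Monotone f) (i : Fin n) :
    expect (derivAt i f) = funInfluence f i / 2 := by
  have habs : (fun x => |f x - f (flipAt i x)|) = fun x => 2 * derivAt i f x := by
    ext x
    rw [← abs_of_nonneg (derivAt_nonneg hf i x), abs_derivAt]
    ring
  rw [funInfluence, habs, expect_const_mul]
  ring

/-! ### Hypercontractivity for even exponents -/

lemma choose_add_two_mul (n k : ℕ) :
    n.choose (k + 2) * ((k + 1) * (k + 2)) = n.choose k * ((n - k) * (n - (k + 1))) := by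
  calc n.choose (k + 2) * ((k + 1) * (k + 2))
      = n.choose (k + 1 + 1) * (k + 1 + 1) * (k + 1) := by ring
    _ = n.choose (k + 1) * (k + 1) * (n - (k + 1)) := by rw [Nat.choose_succ_right_eq]; ring
    _ = n.choose k * ((n - k) * (n - (k + 1))) := by rw [Nat.choose_succ_right_eq, mul_assoc]

lemma choose_two_mul_le (m k : ℕ) :
    (2 * m).choose (2 * k) ≤ (2 * m - 1) ^ k * m.choose k := by
  induction k with
  | zero => simp
  | succ k ih =>
    refine Nat.le_of_mul_le_mul_right (c := (2 * k + 1) * (2 * k + 2)) ?_ (by positivity)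
    calc (2 * m).choose (2 * k + 2) * ((2 * k + 1) * (2 * k + 2))
        = (2 * m).choose (2 * k) * ((2 * m - 2 * k) * (2 * m - (2 * k + 1))) :=
          choose_add_two_mul _ _
      _ ≤ (2 * m - 1) ^ k * m.choose k * ((2 * m - 2 * k) * ((2 * m - 1) * (2 * k + 1))) := by
          gcongr
          exact le_trans (by omega) (Nat.le_mul_of_pos_right _ (by omega))
      _ = (2 * m - 1) ^ (k + 1) * (m.choose k * (m - k)) * (2 * (2 * k + 1)) := by
          rw [← Nat.mul_sub]
          ring
      _ = (2 * m - 1) ^ (k + 1) * m.choose (k + 1) * ((2 * k + 1) * (2 * k + 2)) := by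
          rw [← Nat.choose_succ_right_eq]
          ring

lemma sum_range_two_mul_add_one {M : Type*} [AddCommMonoid M] (F : ℕ → M) (m : ℕ) :
    ∑ i ∈ range (2 * m + 1), F i =
      ∑ k ∈ range (m + 1), F (2 * k) + ∑ k ∈ range m, F (2 * k + 1) := by
  induction m with
  | zero => simp
  | succ m ih =>
    rw [sum_range_succ (fun k => F (2 * k)), sum_range_succ (fun k => F (2 * k + 1)), mul_add_one,
      sum_range_succ, sum_range_succ, ih]
    abel

lemma add_pow_add_sub_pow {R : Type*} [CommRing R] (a b : R) (m : ℕ) :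
    (a + b) ^ (2 * m) + (a - b) ^ (2 * m) =
      2 * ∑ k ∈ range (m + 1), (b ^ 2) ^ k * (a ^ 2) ^ (m - k) * ((2 * m).choose (2 * k) : R) := by
  have hodd : ∀ k, b ^ (2 * k + 1) + (-b) ^ (2 * k + 1) = 0 := fun k => by
    rw [Odd.neg_pow (odd_two_mul_add_one k), add_neg_cancel]
  have heven : ∀ k, b ^ (2 * k) + (-b) ^ (2 * k) = 2 * (b ^ 2) ^ k := fun k => by
    rw [Even.neg_pow (even_two_mul k), pow_mul, two_mul]
  calc (a + b) ^ (2 * m) + (a - b) ^ (2 * m)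
      = ∑ i ∈ range (2 * m + 1), (b ^ i + (-b) ^ i) * (a ^ (2 * m - i) * (2 * m).choose i) := by
        rw [add_comm a, sub_eq_neg_add, add_pow, add_pow, ← sum_add_distrib]
        exact sum_congr rfl fun i _ => by ring
    _ = ∑ k ∈ range (m + 1), 2 * (b ^ 2) ^ k * (a ^ (2 * m - 2 * k) * (2 * m).choose (2 * k)) := by
        simp only [sum_range_two_mul_add_one, hodd, heven, zero_mul, sum_const_zero, add_zero]
    _ = _ := by
        rw [mul_sum]
        refine sum_congr rfl fun k _ => ?_
        rw [← Nat.mul_sub, pow_mul]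
        ring

lemma two_point_le {ρ : ℝ} (hρ : ρ ^ 2 * (2 * m - 1) ≤ 1) (a b : ℝ) :
    ((a + ρ * b) ^ (2 * m) + (a - ρ * b) ^ (2 * m)) / 2 ≤ (a ^ 2 + b ^ 2) ^ m := by
  rcases Nat.eq_zero_or_pos m with rfl | hm
  · simp
  have hcast : ((2 * m - 1 : ℕ) : ℝ) = 2 * m - 1 := by
    rw [Nat.cast_sub (by omega)]
    simp
  rw [← hcast] at hρ
  have hcoeff : ∀ k, (ρ ^ 2) ^ k * ((2 * m).choose (2 * k) : ℝ) ≤ m.choose k := fun k =>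
    calc (ρ ^ 2) ^ k * ((2 * m).choose (2 * k) : ℝ)
        ≤ (ρ ^ 2) ^ k * ((2 * m - 1 : ℕ) ^ k * m.choose k) := by
          gcongr
          exact_mod_cast choose_two_mul_le m k
      _ = (ρ ^ 2 * (2 * m - 1 : ℕ)) ^ k * m.choose k := by rw [mul_pow, mul_assoc]
      _ ≤ m.choose k := mul_le_of_le_one_left (by positivity) (pow_le_one₀ (by positivity) hρ)
  rw [add_pow_add_sub_pow, mul_div_cancel_left₀ _ two_ne_zero, add_comm (a ^ 2), add_pow]
  refine sum_le_sum fun k _ => ?_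
  calc ((ρ * b) ^ 2) ^ k * (a ^ 2) ^ (m - k) * ((2 * m).choose (2 * k) : ℝ)
      = (b ^ 2) ^ k * (a ^ 2) ^ (m - k) * ((ρ ^ 2) ^ k * ((2 * m).choose (2 * k) : ℝ)) := by
        rw [mul_pow ρ, mul_pow (ρ ^ 2)]
        ring
    _ ≤ (b ^ 2) ^ k * (a ^ 2) ^ (m - k) * m.choose k := by gcongr; exact hcoeff k

lemma expect_add_pow_le {u v : Cube n → ℝ} (hu : ∀ x, 0 ≤ u x)
    (hv : ∀ x, 0 ≤ v x) {A B : ℝ} (hA : 0 ≤ A) (hB : 0 ≤ B)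
    (hAu : expect (fun x => u x ^ m) ≤ A ^ m) (hBv : expect (fun x => v x ^ m) ≤ B ^ m) :
    expect (fun x => (u x + v x) ^ m) ≤ (A + B) ^ m := by
  rcases Nat.eq_zero_or_pos m with rfl | hm
  · simp
  have hm1 : (1 : ℝ) ≤ m := by exact_mod_cast hm
  have norm_le_iff : ∀ {w : Cube n → ℝ} {W : ℝ}, (∀ x, 0 ≤ w x) → 0 ≤ W →
      (expect (fun x => w x ^ m) ≤ W ^ m ↔
        (∑ x, w x ^ (m : ℝ)) ^ (1 / (m : ℝ)) ≤ (2 ^ n : ℝ) ^ (1 / (m : ℝ)) * W) := by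
    intro w W hw hW
    simp only [one_div, Real.rpow_natCast]
    rw [Real.rpow_inv_le_iff_of_pos (sum_nonneg fun x _ => pow_nonneg (hw x) m) (by positivity)
      (by linarith), Real.mul_rpow (by positivity) hW, Real.rpow_inv_rpow (by positivity)
      (by linarith), Real.rpow_natCast, expect, div_le_iff₀' (by positivity)]
  rw [norm_le_iff hu hA] at hAu
  rw [norm_le_iff hv hB] at hBv
  rw [norm_le_iff (fun x => add_nonneg (hu x) (hv x)) (add_nonneg hA hB), mul_add]
  exact (Real.Lp_add_le_of_nonneg _ hm1 (fun x _ => hu x) fun x _ => hv x).trans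
    (add_le_add hAu hBv)

lemma expect_succ (f : Cube (n + 1) → ℝ) :
    expect f = expect (fun y : Cube n => (f (Fin.cons false y) + f (Fin.cons true y)) / 2) := by
  have hsum : ∑ x, f x = ∑ y : Cube n, (f (Fin.cons false y) + f (Fin.cons true y)) := by
    rw [← Equiv.sum_comp (Fin.consEquiv fun _ : Fin (n + 1) => Bool) f,
      Fintype.sum_prod_type_right]
    refine sum_congr rfl fun y _ => ?_
    rw [Fintype.sum_bool, add_comm]
    rfl
  rw [expect, expect, hsum, ← sum_div, pow_succ]
  field_simp

lemma noise_cons (ρ : ℝ) (f : Cube (n + 1) → ℝ) (b : Bool) (y : Cube n) :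
    noise ρ f (Fin.cons b y) =
      noise ρ (fun z => (f (Fin.cons false z) + f (Fin.cons true z)) / 2) y +
        ρ * (sgn b * noise ρ (fun z => (f (Fin.cons false z) - f (Fin.cons true z)) / 2) y) := by
  have hkernel : ∀ (b' : Bool) (z : Cube n),
      noiseKernel ρ (Fin.cons b y : Cube (n + 1)) (Fin.cons b' z) =
        (1 + ρ * (sgn b * sgn b')) * noiseKernel ρ y z := fun b' z => by
    simp [noiseKernel, Fin.prod_univ_succ]
  rw [noise, expect_succ]
  simp only [hkernel]
  rw [noise, noise, ← expect_const_mul (sgn b), ← expect_const_mul ρ, ← expect_add]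
  congr 1
  ext z
  simp only [sgn_true, sgn_false]
  ring

theorem expect_noise_pow_le {ρ : ℝ} (hρ : ρ ^ 2 * (2 * m - 1) ≤ 1) (f : Cube n → ℝ) :
    expect (fun x => noise ρ f x ^ (2 * m)) ≤ expect (fun x => f x ^ 2) ^ m := by
  induction n with
  | zero =>
    have hnoise : ∀ x : Cube 0, noise ρ f x = f x := fun x => by
      rw [noise, expect, Fintype.sum_unique]
      simp only [noiseKernel, univ_eq_empty, prod_empty, mul_one, pow_zero, div_one]
      exact congrArg f (Subsingleton.elim _ _)
    simp [hnoise, expect, pow_mul]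
  | succ n ih =>
    let even : Cube n → ℝ := fun z => (f (Fin.cons false z) + f (Fin.cons true z)) / 2
    let odd : Cube n → ℝ := fun z => (f (Fin.cons false z) - f (Fin.cons true z)) / 2
    have hparallelogram : expect (fun x => f x ^ 2) =
        expect (fun y => even y ^ 2) + expect (fun y => odd y ^ 2) := by
      rw [expect_succ, ← expect_add]
      congr 1
      ext y
      simp only [even, odd]
      ring
    have htwo_point : expect (fun x => noise ρ f x ^ (2 * m)) ≤
        expect (fun y => (noise ρ even y ^ 2 + noise ρ odd y ^ 2) ^ m) := by
      rw [expect_succ]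
      refine expect_mono fun y => ?_
      simp only [noise_cons, sgn_false, sgn_true, one_mul, neg_one_mul, mul_neg, ← sub_eq_add_neg]
      exact two_point_le hρ (noise ρ even y) (noise ρ odd y)
    rw [hparallelogram]
    refine htwo_point.trans (expect_add_pow_le (fun y => sq_nonneg _) (fun y => sq_nonneg _)
      (expect_nonneg fun y => sq_nonneg _) (expect_nonneg fun y => sq_nonneg _) ?_ ?_)
    · simpa only [← pow_mul] using ih even
    · simpa only [← pow_mul] using ih odd

/-! ### Bessel's inequality for the noise measure -/

lemma noise_mul_sgn_sub (ρ : ℝ) (f : Cube n → ℝ) (i : Fin n) (x : Cube n) :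
    noise ρ (fun y => f y * (sgn (y i) - ρ * sgn (x i))) x =
      -((1 - ρ ^ 2) * noise ρ (derivAt i f) x) := by
  let K : Cube n → ℝ := fun y => ∏ j ∈ univ.erase i, (1 + ρ * (sgn (x j) * sgn (y j)))
  have hK_flip : ∀ y, K (flipAt i y) = K y := fun y =>
    prod_congr rfl fun j hj => by rw [flipAt_of_ne (ne_of_mem_erase hj)]
  have hkernel : ∀ y, noiseKernel ρ x y = (1 + ρ * (sgn (x i) * sgn (y i))) * K y := fun y =>
    (mul_prod_erase univ (fun j => 1 + ρ * (sgn (x j) * sgn (y j))) (mem_univ i)).symm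
  have hderiv : noise ρ (derivAt i f) x = expect (fun y => derivAt i f y * K y) := by
    have hsplit : (fun y => derivAt i f y * noiseKernel ρ x y) = fun y =>
        derivAt i f y * K y + ρ * sgn (x i) * (derivAt i f y * K y * sgn (y i)) := by
      ext y
      rw [hkernel]
      ring
    rw [noise, hsplit, expect_add, expect_const_mul, expect_mul_sgn_eq_zero i
      (fun y => derivAt i f y * K y) (fun y => by rw [derivAt_flipAt, hK_flip]), mul_zero, add_zero]
  have hfactor : (fun y => f y * (sgn (y i) - ρ * sgn (x i)) * noiseKernel ρ x y) = fun y =>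
      (1 - ρ ^ 2) * (f y * (sgn (y i) * K y)) := by
    ext y
    rw [hkernel]
    linear_combination (f y * K y * ρ * sgn (x i)) * sgn_mul_self (y i) -
      (f y * K y * ρ ^ 2 * sgn (y i)) * sgn_mul_self (x i)
  rw [hderiv, expect_derivAt_mul i f K hK_flip, mul_neg, neg_neg, noise, hfactor, expect_const_mul]

theorem sum_noise_derivAt_sq_le {ρ : ℝ} (h0 : 0 ≤ ρ) (h1 : ρ ≤ 1) (f : Cube n → ℝ) (x : Cube n) :
    (1 - ρ ^ 2) * ∑ i, noise ρ (derivAt i f) x ^ 2 ≤ noise ρ (fun y => f y ^ 2) x := by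
  let c : Fin n → ℝ := fun i => noise ρ (derivAt i f) x
  let q : Cube n → ℝ := fun y => ∑ i, c i * (sgn (y i) - ρ * sgn (x i))
  have hderiv_q : ∀ i, derivAt i q = fun _ => -c i := by
    intro i
    ext y
    simp only [derivAt, q, ← sum_sub_distrib, ← mul_sub]
    rw [sum_eq_single i (fun j _ hj => by simp [hj]) (by simp)]
    simp
    ring
  have hmul_q : ∀ g : Cube n → ℝ, noise ρ (fun y => g y * q y) x =
      -((1 - ρ ^ 2) * ∑ i, c i * noise ρ (derivAt i g) x) := by
    intro g
    simp only [q, mul_sum, mul_left_comm (g _), noise_sum, noise_const_mul, noise_mul_sgn_sub]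
    rw [← sum_neg_distrib]
    exact sum_congr rfl fun i _ => by ring
  have hexpand : (fun y => (f y + q y) ^ 2) = fun y => f y ^ 2 + 2 * (f y * q y) + q y * q y := by
    ext y
    ring
  have hsq := noise_nonneg h0 h1 (fun y => sq_nonneg (f y + q y)) x
  rw [hexpand, noise_add, noise_add, noise_const_mul, hmul_q, hmul_q] at hsq
  simp only [hderiv_q, noise_const, c, mul_neg, sum_neg_distrib, ← sq] at hsq
  linarith

lemma sum_noise_derivAt_sq_le_one {ρ : ℝ} (h0 : 0 ≤ ρ) (h1 : ρ ≤ 1) {f : Cube n → ℝ}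
    (hf : ∀ x, f x ∈ Set.Icc (-1 : ℝ) 1) (x : Cube n) :
    (1 - ρ ^ 2) * ∑ i, noise ρ (derivAt i f) x ^ 2 ≤ 1 := by
  have hsq : 0 ≤ noise ρ (fun y => 1 - f y ^ 2) x :=
    noise_nonneg h0 h1 (fun y => sub_nonneg.2 (sq_le_one_iff_abs_le_one _ |>.2 (abs_le.2 (hf y)))) x
  rw [noise_sub, noise_const] at hsq
  linarith [sum_noise_derivAt_sq_le h0 h1 f x]

lemma funW_one_self_le_one {f : Cube n → ℝ} (hf : ∀ x, f x ∈ Set.Icc (-1 : ℝ) 1) :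
    funW 1 f f ≤ 1 := by
  simpa [noise_zero, funW_one_self_eq_sum_sq] using
    sum_noise_derivAt_sq_le_one le_rfl zero_le_one hf (fun _ => false)

/-! ### Variance under noise -/

/-- The variance of `T_ρ h`. Applied to the discrete derivatives of `f`, it measures how far the
noisy gradient of `f` is from being constant. -/
noncomputable def noiseVar (ρ : ℝ) (h : Cube n → ℝ) : ℝ := funCov (noise ρ h) (noise ρ h)

lemma noiseVar_eq_sum (ρ : ℝ) (h : Cube n → ℝ) :
    noiseVar ρ h = ∑ S ∈ univ.erase ∅, (ρ ^ #S * fourierCoeff h S) ^ 2 := by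
  simp only [noiseVar, funCov_eq_sum, fourierCoeff_noise, sq]

lemma noiseVar_nonneg (ρ : ℝ) (h : Cube n → ℝ) : 0 ≤ noiseVar ρ h := by
  rw [noiseVar_eq_sum]
  positivity

lemma noiseVar_noise (ρ σ : ℝ) (h : Cube n → ℝ) : noiseVar ρ (noise σ h) = noiseVar (ρ * σ) h := by
  rw [noiseVar, noise_noise, noiseVar]

lemma le_add_pow_succ_div_pow {q s : ℝ} (hq : 0 ≤ q) (hs : 0 < s) (m : ℕ) :
    q ≤ s + q ^ (m + 1) / s ^ m := by
  rcases le_total q s with h | h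
  · exact le_add_of_le_of_nonneg h (by positivity)
  · refine le_add_of_nonneg_of_le hs.le ?_
    rw [le_div_iff₀ (by positivity), pow_succ']
    gcongr

lemma mul_mul_le_young {b q h s : ℝ} (hb : 0 ≤ b) (hq : 0 ≤ q) (hh : 0 ≤ h) (hs : 0 < s) (m : ℕ) :
    b * q * h ≤ s * b * h + (s ^ (2 * m))⁻¹ * h ^ 2 + (b / 2) ^ 2 * q ^ (2 * (m + 1)) := by
  calc b * q * h ≤ b * (s + q ^ (m + 1) / s ^ m) * h := by
        gcongr
        exact le_add_pow_succ_div_pow hq hs m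
    _ = s * b * h + 2 * ((s ^ m)⁻¹ * h) * (b / 2 * q ^ (m + 1)) := by ring
    _ ≤ s * b * h + (((s ^ m)⁻¹ * h) ^ 2 + (b / 2 * q ^ (m + 1)) ^ 2) := by
        gcongr
        exact two_mul_le_add_sq _ _
    _ = s * b * h + (s ^ (2 * m))⁻¹ * h ^ 2 + (b / 2) ^ 2 * q ^ (2 * (m + 1)) := by ring

lemma expect_mul_le_of_moment_le {p h : Cube n → ℝ} {b s : ℝ} (hb : 0 < b) (hs : 0 < s)
    (hh : ∀ x, 0 ≤ h x)
    (hp : expect (fun x => p x ^ (2 * (m + 1))) ≤ b ^ (2 * (m + 1))) :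
    expect (fun x => p x * h x) ≤
      s * b * expect h + (s ^ (2 * m))⁻¹ * expect (fun x => h x ^ 2) + (b / 2) ^ 2 := by
  have hpow : ∀ x, (|p x| / b) ^ (2 * (m + 1)) =
      (b ^ (2 * (m + 1)))⁻¹ * p x ^ (2 * (m + 1)) := fun x => by
    rw [div_pow, (even_two_mul _).pow_abs, div_eq_inv_mul]
  calc expect (fun x => p x * h x)
      ≤ expect (fun x => s * b * h x + (s ^ (2 * m))⁻¹ * h x ^ 2 +
          (b / 2) ^ 2 * ((b ^ (2 * (m + 1)))⁻¹ * p x ^ (2 * (m + 1)))) := expect_mono fun x => by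
        rw [← hpow]
        refine le_trans ?_ (mul_mul_le_young hb.le (by positivity) (hh x) hs m)
        rw [mul_div_cancel₀ _ hb.ne']
        exact mul_le_mul_of_nonneg_right (le_abs_self _) (hh x)
    _ = s * b * expect h + (s ^ (2 * m))⁻¹ * expect (fun x => h x ^ 2) +
          (b / 2) ^ 2 * ((b ^ (2 * (m + 1)))⁻¹ * expect (fun x => p x ^ (2 * (m + 1)))) := by
        simp only [expect_add, expect_const_mul]
    _ ≤ s * b * expect h + (s ^ (2 * m))⁻¹ * expect (fun x => h x ^ 2) + (b / 2) ^ 2 := by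
        gcongr
        refine mul_le_of_le_one_right (sq_nonneg _) ?_
        rwa [inv_mul_le_one₀ (by positivity)]

theorem noiseVar_le {ρ s : ℝ} (hρ : ρ ^ 2 * (2 * m + 1) ≤ 1) (hs : 0 < s)
    {h : Cube n → ℝ} (hh : ∀ x, 0 ≤ h x) :
    noiseVar ρ h ≤
      2 * s ^ 2 * expect h ^ 2 + 2 * (s ^ (2 * m))⁻¹ * expect (fun x => h x ^ 2) := by
  have hE2 : 0 ≤ expect (fun x => h x ^ 2) := expect_nonneg fun x => sq_nonneg _
  rcases (noiseVar_nonneg ρ h).eq_or_lt with hzero | hpos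
  · rw [← hzero]
    positivity
  let k : Cube n → ℝ := fun x => noise ρ h x - expect h
  have hsq : √(noiseVar ρ h) ^ 2 = noiseVar ρ h := Real.sq_sqrt hpos.le
  have hk : expect (fun x => k x ^ 2) = noiseVar ρ h := by
    rw [noiseVar, funCov_self_eq_expect_sub_sq, expect_noise]
  have hkh : expect (fun x => noise ρ k x * h x) = noiseVar ρ h := by
    have hnoise : noise ρ k = fun x => noise ρ (noise ρ h) x - expect h := by
      ext x
      rw [noise_sub, noise_const]
    rw [hnoise, noiseVar, ← funCov_noise_left, funCov, expect_noise, expect_noise,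
      ← expect_const_mul, ← expect_sub]
    simp only [sub_mul]
  have hmoment : expect (fun x => noise ρ k x ^ (2 * (m + 1))) ≤
      √(noiseVar ρ h) ^ (2 * (m + 1)) := by
    rw [pow_mul √_, hsq, ← hk]
    refine expect_noise_pow_le ?_ k
    push_cast
    linarith
  have hbound := expect_mul_le_of_moment_le (Real.sqrt_pos.2 hpos) hs hh hmoment
  rw [hkh, div_pow, hsq] at hbound
  nlinarith [sq_nonneg (s * expect h - √(noiseVar ρ h) / 2)]

/-- Half of the noise is used to bound the second moments by Bessel's inequality, the other half
for hypercontractivity. -/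
theorem sum_noiseVar_derivAt_le {ρ s : ℝ} (hρ : ρ ^ 2 * (2 * m + 1) ≤ 1) (hs : 0 < s)
    {f : Cube n → ℝ} (hf : IncreasingBounded f) :
    ∑ i, noiseVar (ρ * √(1 / 2)) (derivAt i f) ≤
      2 * s ^ 2 * funW 1 f f + 4 * (s ^ (2 * m))⁻¹ := by
  have hσ0 : 0 ≤ √(1 / 2 : ℝ) := Real.sqrt_nonneg _
  have hσ1 : √(1 / 2 : ℝ) ≤ 1 := Real.sqrt_le_one.2 (by norm_num)
  have hbessel : ∑ i, expect (fun x => noise √(1 / 2) (derivAt i f) x ^ 2) ≤ 2 := by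
    rw [← expect_sum]
    refine (expect_mono fun x => ?_).trans (expect_const 2).le
    have hx := sum_noise_derivAt_sq_le_one hσ0 hσ1 hf.2 x
    rw [Real.sq_sqrt (by norm_num)] at hx
    linarith
  calc ∑ i, noiseVar (ρ * √(1 / 2)) (derivAt i f)
      ≤ ∑ i, (2 * s ^ 2 * expect (derivAt i f) ^ 2 +
          2 * (s ^ (2 * m))⁻¹ * expect (fun x => noise √(1 / 2) (derivAt i f) x ^ 2)) := by
        refine sum_le_sum fun i _ => ?_
        rw [← noiseVar_noise, ← expect_noise √(1 / 2)]
        exact noiseVar_le hρ hs (noise_nonneg hσ0 hσ1 (derivAt_nonneg hf.1 i))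
    _ = 2 * s ^ 2 * funW 1 f f + 2 * (s ^ (2 * m))⁻¹ *
          ∑ i, expect (fun x => noise √(1 / 2) (derivAt i f) x ^ 2) := by
        rw [sum_add_distrib, ← mul_sum, ← mul_sum, funW_one_self_eq_sum_sq]
    _ ≤ 2 * s ^ 2 * funW 1 f f + 2 * (s ^ (2 * m))⁻¹ * 2 := by gcongr
    _ = 2 * s ^ 2 * funW 1 f f + 4 * (s ^ (2 * m))⁻¹ := by ring

/-! ### Covariance and noise -/

lemma noiseCorr_derivAt (i : Fin n) (f g : Cube n → ℝ) (ρ : ℝ) :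
    noiseCorr (derivAt i f) (derivAt i g) ρ =
      ∑ S with i ∈ S, ρ ^ (#S - 1) * (fourierCoeff f S * fourierCoeff g S) := by
  have hmem : ∀ S : Finset (Fin n), i ∈ S →
      ρ ^ #S * (fourierCoeff (derivAt i f) S * fourierCoeff (derivAt i g) S) = 0 := fun S hi => by
    rw [fourierCoeff_derivAt_of_mem hi, zero_mul, mul_zero]
  rw [noiseCorr_eq_sum, ← sum_filter_add_sum_filter_not univ (i ∈ ·),
    sum_eq_zero fun S hS => hmem S (mem_filter.1 hS).2, zero_add]
  refine sum_nbij' (insert i) (fun S => S.erase i) (by simp) (by simp)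
    (fun S hS => erase_insert (mem_filter.1 hS).2) (fun S hS => insert_erase (mem_filter.1 hS).2)
    fun S hS => ?_
  have hi : i ∉ S := (mem_filter.1 hS).2
  rw [fourierCoeff_derivAt_of_notMem hi, fourierCoeff_derivAt_of_notMem hi, neg_mul_neg,
    card_insert_of_notMem hi, Nat.add_sub_cancel]

lemma hasDerivAt_noiseCorr (f g : Cube n → ℝ) (ρ : ℝ) :
    HasDerivAt (noiseCorr f g) (∑ i, noiseCorr (derivAt i f) (derivAt i g) ρ) ρ := by
  have hsum : ∑ i, noiseCorr (derivAt i f) (derivAt i g) ρ = ∑ S : Finset (Fin n),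
      #S * ρ ^ (#S - 1) * (fourierCoeff f S * fourierCoeff g S) := by
    simp only [noiseCorr_derivAt, sum_filter]
    rw [sum_comm]
    refine sum_congr rfl fun S _ => ?_
    rw [sum_ite_mem, univ_inter, sum_const, nsmul_eq_mul, mul_assoc]
  rw [hsum, funext (noiseCorr_eq_sum f g)]
  exact HasDerivAt.fun_sum fun S _ => (hasDerivAt_pow #S ρ).mul_const _

lemma mul_sub_le_noiseCorr_sub {f g : Cube n → ℝ} {a b C : ℝ} (hab : a ≤ b)
    (h : ∀ ρ ∈ Set.Icc a b, C ≤ ∑ i, noiseCorr (derivAt i f) (derivAt i g) ρ) :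
    C * (b - a) ≤ noiseCorr f g b - noiseCorr f g a :=
  (convex_Icc a b).mul_sub_le_image_sub_of_le_deriv
    (fun ρ _ => (hasDerivAt_noiseCorr f g ρ).continuousAt.continuousWithinAt)
    (fun ρ _ => (hasDerivAt_noiseCorr f g ρ).differentiableAt.differentiableWithinAt)
    (fun ρ hρ => (h ρ (interior_subset hρ)).trans_eq (hasDerivAt_noiseCorr f g ρ).deriv.symm)
    a (Set.left_mem_Icc.2 hab) b (Set.right_mem_Icc.2 hab) hab

theorem noiseCorr_sub_le_funCov {f g : Cube n → ℝ} (hf : Monotone f) (hg : Monotone g)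
    {ρ : ℝ} (h0 : 0 ≤ ρ) (h1 : ρ ≤ 1) : noiseCorr f g ρ - noiseCorr f g 0 ≤ funCov f g := by
  have hincr : 0 * (1 - ρ) ≤ noiseCorr f g 1 - noiseCorr f g ρ :=
    mul_sub_le_noiseCorr_sub h1 fun σ hσ => sum_nonneg fun i _ => expect_nonneg fun x =>
      mul_nonneg (noise_nonneg (h0.trans hσ.1) hσ.2 (derivAt_nonneg hf i) x) (derivAt_nonneg hg i x)
  rw [funCov_eq_noiseCorr_sub]
  linarith

lemma funCov_nonneg {f g : Cube n → ℝ} (hf : Monotone f) (hg : Monotone g) : 0 ≤ funCov f g := by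
  simpa using noiseCorr_sub_le_funCov hf hg le_rfl zero_le_one

lemma funW_one_nonneg {f g : Cube n → ℝ} (hf : Monotone f) (hg : Monotone g) :
    0 ≤ funW 1 f g := by
  rw [funW_one_eq_sum]
  exact sum_nonneg fun i _ => mul_nonneg (expect_nonneg (derivAt_nonneg hf i))
    (expect_nonneg (derivAt_nonneg hg i))

lemma expect_mul_expect_sub_le_noiseCorr (f g : Cube n → ℝ) {r q η ρ : ℝ} (hr : 0 ≤ r)
    (hq : 0 ≤ q) (hη0 : 0 ≤ η) (hη1 : η ≤ 1) (hρ0 : 0 ≤ ρ) (hρ : ρ ≤ η * (r * q)) :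
    expect f * expect g - η * (√(noiseVar r f) * √(noiseVar q g)) ≤ noiseCorr f g ρ := by
  let a : Finset (Fin n) → ℝ := fun S => r ^ #S * fourierCoeff f S
  let b : Finset (Fin n) → ℝ := fun S => q ^ #S * fourierCoeff g S
  have hterm : ∀ S ∈ univ.erase (∅ : Finset (Fin n)),
      -(η * (|a S| * |b S|)) ≤ ρ ^ #S * (fourierCoeff f S * fourierCoeff g S) := by
    intro S hS
    have hne : S.Nonempty := nonempty_iff_ne_empty.2 (ne_of_mem_erase hS)
    have hpow : ρ ^ #S ≤ η * (r ^ #S * q ^ #S) :=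
      calc ρ ^ #S ≤ (η * (r * q)) ^ #S := by gcongr
        _ = η ^ #S * (r ^ #S * q ^ #S) := by rw [mul_pow, mul_pow]
        _ ≤ η * (r ^ #S * q ^ #S) := by
          gcongr
          exact pow_le_of_le_one hη0 hη1 (card_ne_zero.2 hne)
    refine neg_le_of_neg_le ((neg_le_abs _).trans ?_)
    calc |ρ ^ #S * (fourierCoeff f S * fourierCoeff g S)|
        = ρ ^ #S * (|fourierCoeff f S| * |fourierCoeff g S|) := by
          rw [abs_mul, abs_mul, abs_of_nonneg (pow_nonneg hρ0 _)]
      _ ≤ η * (r ^ #S * q ^ #S) * (|fourierCoeff f S| * |fourierCoeff g S|) := by gcongr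
      _ = η * (|a S| * |b S|) := by
          rw [abs_mul, abs_mul, abs_of_nonneg (pow_nonneg hr _), abs_of_nonneg (pow_nonneg hq _)]
          ring
  have hcs : ∑ S ∈ univ.erase ∅, |a S| * |b S| ≤ √(noiseVar r f) * √(noiseVar q g) := by
    simpa only [noiseVar_eq_sum, sq_abs] using
      Real.sum_mul_le_sqrt_mul_sqrt (univ.erase ∅) (fun S => |a S|) (fun S => |b S|)
  rw [noiseCorr_eq_expect_mul_expect_add, sub_eq_add_neg]
  gcongr
  calc -(η * (√(noiseVar r f) * √(noiseVar q g)))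
      ≤ -(η * ∑ S ∈ univ.erase ∅, |a S| * |b S|) := by gcongr
    _ = ∑ S ∈ univ.erase ∅, -(η * (|a S| * |b S|)) := by rw [mul_sum, sum_neg_distrib]
    _ ≤ ∑ S ∈ univ.erase ∅, ρ ^ #S * (fourierCoeff f S * fourierCoeff g S) := sum_le_sum hterm

lemma funW_one_sub_le_sum_noiseCorr (f g : Cube n → ℝ) {r q η ρ : ℝ} (hr : 0 ≤ r)
    (hq : 0 ≤ q) (hη0 : 0 ≤ η) (hη1 : η ≤ 1) (hρ0 : 0 ≤ ρ) (hρ : ρ ≤ η * (r * q)) :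
    funW 1 f g - η * (√(∑ i, noiseVar r (derivAt i f)) * √(∑ i, noiseVar q (derivAt i g))) ≤
      ∑ i, noiseCorr (derivAt i f) (derivAt i g) ρ := by
  calc funW 1 f g - η * (√(∑ i, noiseVar r (derivAt i f)) * √(∑ i, noiseVar q (derivAt i g)))
      ≤ funW 1 f g - η * ∑ i, √(noiseVar r (derivAt i f)) * √(noiseVar q (derivAt i g)) := by
        gcongr
        exact Real.sum_sqrt_mul_sqrt_le univ (fun i => noiseVar_nonneg r _)
          fun i => noiseVar_nonneg q _
    _ = ∑ i, (expect (derivAt i f) * expect (derivAt i g) -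
          η * (√(noiseVar r (derivAt i f)) * √(noiseVar q (derivAt i g)))) := by
        rw [funW_one_eq_sum, mul_sum, sum_sub_distrib]
    _ ≤ ∑ i, noiseCorr (derivAt i f) (derivAt i g) ρ := sum_le_sum fun i _ =>
        expect_mul_expect_sub_le_noiseCorr _ _ hr hq hη0 hη1 hρ0 hρ

theorem funW_one_mul_le_funCov {f g : Cube n → ℝ} (hf : Monotone f) (hg : Monotone g)
    {r q η : ℝ} (hr : r ∈ Set.Icc 0 1) (hq : q ∈ Set.Icc 0 1) (hη : η ∈ Set.Icc 0 1)
    (hvar : η * (√(∑ i, noiseVar r (derivAt i f)) * √(∑ i, noiseVar q (derivAt i g))) ≤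
      funW 1 f g / 2) :
    funW 1 f g / 2 * (η * (r * q)) ≤ funCov f g := by
  have hR0 : 0 ≤ η * (r * q) := mul_nonneg hη.1 (mul_nonneg hr.1 hq.1)
  have hR1 : η * (r * q) ≤ 1 :=
    mul_le_one₀ hη.2 (mul_nonneg hr.1 hq.1) (mul_le_one₀ hr.2 hq.1 hq.2)
  calc funW 1 f g / 2 * (η * (r * q)) = funW 1 f g / 2 * (η * (r * q) - 0) := by rw [sub_zero]
    _ ≤ noiseCorr f g (η * (r * q)) - noiseCorr f g 0 :=
        mul_sub_le_noiseCorr_sub hR0 fun ρ hρ => by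
          linarith [funW_one_sub_le_sum_noiseCorr f g hr.1 hq.1 hη.1 hη.2 hρ.1 hρ.2]
    _ ≤ funCov f g := noiseCorr_sub_le_funCov hf hg hR0 hR1

/-! ### The correlation inequality -/

lemma log_exp_one_div {u : ℝ} (hu : u ≠ 0) : Real.log (Real.exp 1 / u) = 1 - Real.log u := by
  rw [Real.log_div (Real.exp_ne_zero 1) hu, Real.log_exp]

lemma exists_noise_strength {f : Cube n → ℝ} (hf : IncreasingBounded f) (hu : 0 < funW 1 f f) :
    ∃ r ∈ Set.Icc (0 : ℝ) 1, 1 / √(6 * Real.log (Real.exp 1 / funW 1 f f)) ≤ r ∧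
      ∑ i, noiseVar r (derivAt i f) ≤ 20 * funW 1 f f := by
  have hlog : Real.log (funW 1 f f) ≤ 0 := Real.log_nonpos hu.le (funW_one_self_le_one hf.2)
  let m := ⌈-Real.log (funW 1 f f) / 2⌉₊
  have hm_ge : -Real.log (funW 1 f f) / 2 ≤ m := Nat.le_ceil _
  have hm_lt : (m : ℝ) < -Real.log (funW 1 f f) / 2 + 1 := Nat.ceil_lt_add_one (by linarith)
  have hr_eq : √(1 / (2 * m + 1)) * √(1 / 2) = 1 / √(2 * (2 * m + 1)) := by
    rw [← Real.sqrt_mul (by positivity), one_div_mul_one_div, mul_comm (2 * (m : ℝ) + 1),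
      Real.sqrt_div zero_le_one, Real.sqrt_one]
  refine ⟨√(1 / (2 * m + 1)) * √(1 / 2), ⟨by positivity, ?_⟩, ?_, ?_⟩
  · rw [hr_eq, div_le_one (by positivity), Real.one_le_sqrt]
    linarith [m.cast_nonneg (α := ℝ)]
  · rw [hr_eq, log_exp_one_div hu.ne']
    refine one_div_le_one_div_of_le (by positivity) (Real.sqrt_le_sqrt ?_)
    linarith
  · have htail : (Real.exp 1 ^ (2 * m))⁻¹ ≤ funW 1 f f := by
      rw [← Real.exp_nat_mul, ← Real.exp_neg, ← Real.le_log_iff_exp_le hu]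
      push_cast
      linarith
    have hexp : Real.exp 1 ^ 2 ≤ 8 := by
      nlinarith [Real.exp_one_lt_d9, Real.exp_pos 1]
    have hstrength : √(1 / (2 * m + 1) : ℝ) ^ 2 * (2 * m + 1) ≤ 1 := by
      rw [Real.sq_sqrt (by positivity), one_div_mul_cancel (by positivity)]
    nlinarith [sum_noiseVar_derivAt_le hstrength (Real.exp_pos 1) hf]

lemma sqrt_mul_sqrt_le_of_mul_le {a b C u v w K : ℝ} (hC : 0 ≤ C) (hw : 0 ≤ w) (hu : 0 ≤ u)
    (ha : a ≤ C * u) (hb : b ≤ C * v) (huv : u * v ≤ K * w ^ 2) :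
    √a * √b ≤ C * (√K * w) := by
  calc √a * √b ≤ √(C * u) * √(C * v) := by gcongr
    _ = C * √(u * v) := by
        rw [← Real.sqrt_mul (by positivity), mul_mul_mul_comm, Real.sqrt_mul (by positivity),
          Real.sqrt_mul_self hC]
    _ ≤ C * √(K * w ^ 2) := by gcongr
    _ = C * (√K * w) := by rw [Real.sqrt_mul' _ (sq_nonneg w), Real.sqrt_sq hw]

theorem corrBound_le_funCov {K : ℝ} {f g : Cube n → ℝ} (hf : IncreasingBounded f)
    (hg : IncreasingBounded g) (hangle : funW 1 f f * funW 1 g g ≤ K * funW 1 f g ^ 2) :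
    corrBound (funW 1 f g) (funW 1 f f) (funW 1 g g) ≤ 12 * max 1 (40 * √K) * funCov f g := by
  have hcov := funCov_nonneg hf.1 hg.1
  have hw := funW_one_nonneg hf.1 hg.1
  rcases (funW_one_self_nonneg f).eq_or_lt with hu | hu
  · simpa [corrBound, ← hu] using hcov
  rcases (funW_one_self_nonneg g).eq_or_lt with hv | hv
  · simpa [corrBound, ← hv] using hcov
  obtain ⟨r, hr, hr_ge, hr_var⟩ := exists_noise_strength hf hu
  obtain ⟨q, hq, hq_ge, hq_var⟩ := exists_noise_strength hg hv
  let M := max 1 (40 * √K)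
  have hM : 1 ≤ M := le_max_left _ _
  have hMK : 40 * √K ≤ M := le_max_right _ _
  have hvar : M⁻¹ * (√(∑ i, noiseVar r (derivAt i f)) * √(∑ i, noiseVar q (derivAt i g))) ≤
      funW 1 f g / 2 := by
    rw [inv_mul_le_iff₀ (by positivity)]
    nlinarith [sqrt_mul_sqrt_le_of_mul_le (by norm_num) hw hu.le hr_var hq_var hangle]
  have hlower := funW_one_mul_le_funCov hf.1 hg.1 hr hq
    ⟨inv_nonneg.2 (by positivity), inv_le_one_of_one_le₀ hM⟩ hvar
  calc corrBound (funW 1 f g) (funW 1 f f) (funW 1 g g)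
      = 6 * funW 1 f g * (1 / √(6 * Real.log (Real.exp 1 / funW 1 f f)) *
          (1 / √(6 * Real.log (Real.exp 1 / funW 1 g g)))) := by
        have hsqrt6 : √(6 : ℝ) * √6 = 6 := Real.mul_self_sqrt (by norm_num)
        rw [Real.sqrt_mul (by norm_num), Real.sqrt_mul (by norm_num), corrBound,
          div_mul_div_comm, mul_mul_mul_comm, hsqrt6]
        ring
    _ ≤ 6 * funW 1 f g * (r * q) := by gcongr; exact hr.1
    _ = 12 * M * (funW 1 f g / 2 * (M⁻¹ * (r * q))) := by
        field_simp
        ring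
    _ ≤ 12 * M * funCov f g := by gcongr

/-! ### Weakly similar functions -/

lemma funW_one_eq_sum_funInfluence {f g : Cube n → ℝ} (hf : Monotone f) (hg : Monotone g) :
    funW 1 f g = ∑ i, funInfluence f i / 2 * (funInfluence g i / 2) := by
  simp only [funW_one_eq_sum, expect_derivAt_eq_funInfluence hf, expect_derivAt_eq_funInfluence hg]

lemma funInfluence_nonneg (f : Cube n → ℝ) (i : Fin n) : 0 ≤ funInfluence f i :=
  expect_nonneg fun _ => abs_nonneg _

lemma WeaklyEqualRatios.sum_mul_self_mul_le {K : ℝ} {a b : Fin n → ℝ} (ha : ∀ i, 0 ≤ a i)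
    (hb : ∀ i, 0 ≤ b i) (h : WeaklyEqualRatios K a b) :
    (∑ i, a i * a i) * (∑ i, b i * b i) ≤ K * (∑ i, a i * b i) ^ 2 := by
  rw [sq, sum_mul_sum, sum_mul_sum, mul_sum]
  refine sum_le_sum fun i _ => ?_
  rw [mul_sum]
  refine sum_le_sum fun j _ => ?_
  linarith [mul_le_mul_of_nonneg_right (h i j) (mul_nonneg (ha i) (hb j))]

lemma EqualRatios.weaklyEqualRatios {a b : Fin n → ℝ} (h : EqualRatios a b) :
    WeaklyEqualRatios 1 a b := fun i j => by rw [h i j, one_mul]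

lemma equalRatios_of_const {a b : Fin n → ℝ} (ha : ∀ i j, a i = a j) (hb : ∀ i j, b i = b j) :
    EqualRatios a b := fun i j => by rw [ha i j, hb i j]

lemma FunWeaklySimilar.funW_one_mul_le {K : ℝ} {f g : Cube n → ℝ} (hf : Monotone f)
    (hg : Monotone g) (h : FunWeaklySimilar K f g) :
    funW 1 f f * funW 1 g g ≤ K * funW 1 f g ^ 2 := by
  have hhalf : ∀ (h : Cube n → ℝ) (i), 0 ≤ funInfluence h i / 2 := fun h i =>
    div_nonneg (funInfluence_nonneg h i) zero_le_two
  rw [funW_one_eq_sum_funInfluence hf hf, funW_one_eq_sum_funInfluence hg hg,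
    funW_one_eq_sum_funInfluence hf hg]
  refine WeaklyEqualRatios.sum_mul_self_mul_le (hhalf f) (hhalf g) fun i j => ?_
  linarith [h i j]

theorem FunWeaklySimilar.corrBound_le_funCov {K : ℝ} {f g : Cube n → ℝ}
    (h : FunWeaklySimilar K f g) (hf : IncreasingBounded f) (hg : IncreasingBounded g) :
    corrBound (funW 1 f g) (funW 1 f f) (funW 1 g g) ≤ 12 * max 1 (40 * √K) * funCov f g :=
  CubeCorrelation.corrBound_le_funCov hf hg (h.funW_one_mul_le hf.1 hg.1)

/-! ### Families as sign functions -/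

/-- The function `2 · 1_A - 1`, with values `±1`. Unlike the indicator function of `A`, it makes
`W_1` of functions and `W_1` of families agree. -/
noncomputable def signFun (A : Set (Cube n)) (x : Cube n) : ℝ := 2 * A.indicator 1 x - 1

lemma signFun_of_mem {A : Set (Cube n)} {x : Cube n} (hx : x ∈ A) : signFun A x = 1 := by
  rw [signFun, Set.indicator_of_mem hx, Pi.one_apply]
  norm_num

lemma signFun_of_notMem {A : Set (Cube n)} {x : Cube n} (hx : x ∉ A) : signFun A x = -1 := by
  rw [signFun, Set.indicator_of_notMem hx]
  norm_num

lemma increasingBounded_signFun {A : Set (Cube n)} (hA : IsUpperSet A) :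
    IncreasingBounded (signFun A) := by
  have hrange : ∀ x, signFun A x ∈ Set.Icc (-1 : ℝ) 1 := fun x => by
    by_cases hx : x ∈ A
    · simp [signFun_of_mem hx]
    · simp [signFun_of_notMem hx]
  refine ⟨fun x y hxy => ?_, hrange⟩
  by_cases hx : x ∈ A
  · rw [signFun_of_mem hx, signFun_of_mem (hA hxy hx)]
  · rw [signFun_of_notMem hx]
    exact (hrange y).1

lemma mu_eq_expect (A : Set (Cube n)) : mu A = expect (A.indicator 1) := by
  classical
  simp only [mu, expect, Set.ncard_eq_toFinset_card', Set.indicator_apply, Pi.one_apply, sum_boole,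
    Set.filter_mem_univ_eq_toFinset]

lemma funCov_signFun (A B : Set (Cube n)) : funCov (signFun A) (signFun B) = 4 * famCov A B := by
  have hmul : ∀ x, signFun A x * signFun B x =
      4 * (A ∩ B).indicator 1 x - 2 * A.indicator 1 x - (2 * B.indicator 1 x - 1) := fun x => by
    rw [Set.inter_indicator_one, Pi.mul_apply, signFun, signFun]
    ring
  have hexpect : ∀ A : Set (Cube n), expect (signFun A) = 2 * mu A - 1 := fun A => by
    rw [mu_eq_expect, ← expect_const_mul, ← expect_const (n := n) 1, ← expect_sub]
    rfl
  simp only [funCov, hmul, hexpect, expect_sub, expect_const_mul, expect_const, ← mu_eq_expect,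
    famCov]
  ring

lemma funInfluence_signFun (A : Set (Cube n)) (i : Fin n) :
    funInfluence (signFun A) i = 2 * famInfluence A i := by
  let D : Set (Cube n) := {x | x ∈ A ∧ flipAt i x ∉ A}
  have habs : ∀ x, |signFun A x - signFun A (flipAt i x)| =
      2 * D.indicator 1 x + 2 * D.indicator 1 (flipAt i x) := fun x => by
    by_cases hx : x ∈ A <;> by_cases hy : flipAt i x ∈ A <;>
      norm_num [signFun, D, Set.indicator, flipAt_flipAt, hx, hy]
  simp only [funInfluence, habs, expect_add, expect_const_mul, expect_flipAt i (D.indicator 1),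
    famInfluence, mu_eq_expect]
  ring

lemma funW_one_signFun {A B : Set (Cube n)} (hA : IsUpperSet A) (hB : IsUpperSet B) :
    funW 1 (signFun A) (signFun B) = famW1 A B := by
  rw [funW_one_eq_sum_funInfluence (increasingBounded_signFun hA).1
    (increasingBounded_signFun hB).1]
  simp only [funInfluence_signFun, mul_div_cancel_left₀ _ (two_ne_zero' ℝ), famW1]

lemma FamWeaklySimilar.signFun {K : ℝ} {A B : Set (Cube n)} (h : FamWeaklySimilar K A B) :
    FunWeaklySimilar K (signFun A) (signFun B) := fun i j => by
  simp only [funInfluence_signFun]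
  linarith [h i j]

theorem FamWeaklySimilar.corrBound_le_famCov {K : ℝ} {A B : Set (Cube n)}
    (h : FamWeaklySimilar K A B) (hA : IsUpperSet A) (hB : IsUpperSet B) :
    corrBound (famW1 A B) (famW1 A A) (famW1 B B) ≤ 48 * max 1 (40 * √K) * famCov A B := by
  have hsign := h.signFun.corrBound_le_funCov (increasingBounded_signFun hA)
    (increasingBounded_signFun hB)
  rw [funCov_signFun, funW_one_signFun hA hB, funW_one_signFun hA hA,
    funW_one_signFun hB hB] at hsign
  linarith

theorem exists_mul_corrBound_le_of_weaklySimilar (K : ℝ) : ∃ c : ℝ, 0 < c ∧ ∀ n : ℕ,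
    (∀ A B : Set (Cube n), IsUpperSet A → IsUpperSet B → FamWeaklySimilar K A B →
      c * corrBound (famW1 A B) (famW1 A A) (famW1 B B) ≤ famCov A B) ∧
    (∀ f g : Cube n → ℝ, IncreasingBounded f → IncreasingBounded g → FunWeaklySimilar K f g →
      c * corrBound (funW 1 f g) (funW 1 f f) (funW 1 g g) ≤ funCov f g) := by
  refine ⟨(48 * max 1 (40 * √K))⁻¹, by positivity, fun n =>
    ⟨fun A B hA hB h => ?_, fun f g hf hg h => ?_⟩⟩ <;> rw [inv_mul_le_iff₀ (by positivity)]
  · exact h.corrBound_le_famCov hA hB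
  · refine (h.corrBound_le_funCov hf hg).trans ?_
    gcongr
    · exact funCov_nonneg hf.1 hg.1
    · norm_num

lemma corrBound_nonneg {u v w : ℝ} (hw : 0 ≤ w) : 0 ≤ corrBound w u v :=
  div_nonneg hw (by positivity)

lemma famInfluence_nonneg (A : Set (Cube n)) (i : Fin n) : 0 ≤ famInfluence A i := by
  unfold famInfluence mu
  positivity

lemma famW1_nonneg (A B : Set (Cube n)) : 0 ≤ famW1 A B :=
  sum_nonneg fun i _ => mul_nonneg (famInfluence_nonneg A i) (famInfluence_nonneg B i)

/-! ### Regular families and functions -/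

lemma sum_eq_mul_of_const {a : Fin n → ℝ} (ha : ∀ i j, a i = a j) (i : Fin n) :
    ∑ j, a j = n * a i := by
  rw [sum_congr rfl fun j _ => ha j i, sum_const, card_univ, Fintype.card_fin, nsmul_eq_mul]

lemma sum_mul_eq_div_of_const (a : Fin n → ℝ) {b : Fin n → ℝ} (hb : ∀ i j, b i = b j) :
    ∑ i, a i * b i = (∑ i, a i) * (∑ i, b i) / n := by
  rw [mul_div_assoc, sum_mul]
  refine sum_congr rfl fun i _ => ?_
  have hn : (n : ℝ) ≠ 0 := Nat.cast_ne_zero.2 i.pos.ne'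
  rw [sum_eq_mul_of_const hb i, mul_div_cancel_left₀ _ hn]

lemma corrBound_eq_sum_of_const {a b : Fin n → ℝ} (ha : ∀ i j, a i = a j)
    (hb : ∀ i j, b i = b j) :
    corrBound (∑ i, a i * b i) (∑ i, a i * a i) (∑ i, b i * b i) =
      ∑ i, a i / √(Real.log (Real.exp 1 / (n * a i ^ 2))) *
        (b i / √(Real.log (Real.exp 1 / (n * b i ^ 2)))) := by
  have hsq : ∀ {c : Fin n → ℝ}, (∀ i j, c i = c j) → ∀ i, n * c i ^ 2 = ∑ j, c j * c j :=
    fun hc i => by rw [sum_eq_mul_of_const (fun j k => by rw [hc j k]) i, sq]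
  simp only [hsq ha, hsq hb, div_mul_div_comm, ← sum_div, corrBound]

lemma corrBound_eq_div_of_const {a b : Fin n → ℝ} (ha : ∀ i j, a i = a j)
    (hb : ∀ i j, b i = b j) :
    corrBound (∑ i, a i * b i) (∑ i, a i * a i) (∑ i, b i * b i) =
      (∑ i, a i) * (∑ i, b i) /
        (n * √(Real.log (Real.exp 1 * n / (∑ i, a i) ^ 2)) *
          √(Real.log (Real.exp 1 * n / (∑ i, b i) ^ 2))) := by
  rw [corrBound, sum_mul_eq_div_of_const a hb, sum_mul_eq_div_of_const a ha,
    sum_mul_eq_div_of_const b hb, div_div_eq_mul_div, div_div_eq_mul_div, ← sq, ← sq, div_div,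
    mul_assoc]

lemma four_mul_corrBound_eq_of_funRegular {f g : Cube n → ℝ} (hf : Monotone f) (hg : Monotone g)
    (hf' : FunRegular f) (hg' : FunRegular g) :
    4 * corrBound (funW 1 f g) (funW 1 f f) (funW 1 g g) =
      funTotalInfluence f * funTotalInfluence g /
        (n * √(Real.log (4 * Real.exp 1 * n / funTotalInfluence f ^ 2)) *
          √(Real.log (4 * Real.exp 1 * n / funTotalInfluence g ^ 2))) := by
  have hlog : ∀ T : ℝ, Real.exp 1 * n / (T / 2) ^ 2 = 4 * Real.exp 1 * n / T ^ 2 := fun T => by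
    rw [div_pow, div_div_eq_mul_div]
    ring
  rw [funW_one_eq_sum_funInfluence hf hg, funW_one_eq_sum_funInfluence hf hf,
    funW_one_eq_sum_funInfluence hg hg, corrBound_eq_div_of_const
      (fun i j => by rw [hf' i j]) (fun i j => by rw [hg' i j]), ← sum_div, ← sum_div, hlog, hlog,
    funTotalInfluence, funTotalInfluence]
  ring

end CubeCorrelation

theorem mainTheorem1 :
    -- similar and regular pairs, with one universal constant
    (∃ c : ℝ, 0 < c ∧ ∀ n : ℕ,
      (∀ A B : Set (Cube n), IsUpperSet A → IsUpperSet B → FamSimilar A B →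
        famCov A B ≥ c * corrBound (famW1 A B) (famW1 A A) (famW1 B B)) ∧
      (∀ A B : Set (Cube n), IsUpperSet A → IsUpperSet B → FamRegular A → FamRegular B →
        famCov A B ≥
            c * ∑ i, famInfluence A i / √(Real.log (Real.exp 1 / (n * famInfluence A i ^ 2))) *
              (famInfluence B i / √(Real.log (Real.exp 1 / (n * famInfluence B i ^ 2)))) ∧
        c * ∑ i, famInfluence A i / √(Real.log (Real.exp 1 / (n * famInfluence A i ^ 2))) *
              (famInfluence B i / √(Real.log (Real.exp 1 / (n * famInfluence B i ^ 2)))) =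
          c * (famTotalInfluence A * famTotalInfluence B /
            (n * √(Real.log (Real.exp 1 * n / famTotalInfluence A ^ 2)) *
              √(Real.log (Real.exp 1 * n / famTotalInfluence B ^ 2))))) ∧
      (∀ f g : Cube n → ℝ, IncreasingBounded f → IncreasingBounded g → FunSimilar f g →
        funCov f g ≥ c * corrBound (funW 1 f g) (funW 1 f f) (funW 1 g g)) ∧
      (∀ f g : Cube n → ℝ, IncreasingBounded f → IncreasingBounded g →
        FunRegular f → FunRegular g →
        funCov f g ≥ c * (funTotalInfluence f * funTotalInfluence g /
            (n * √(Real.log (4 * Real.exp 1 * n / funTotalInfluence f ^ 2)) *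
              √(Real.log (4 * Real.exp 1 * n / funTotalInfluence g ^ 2)))))) ∧
    -- weakly similar pairs, with a constant that depends only on the similarity constant
    (∀ K : ℝ, 0 < K → ∃ c : ℝ, 0 < c ∧ ∀ n : ℕ,
      (∀ A B : Set (Cube n), IsUpperSet A → IsUpperSet B → FamWeaklySimilar K A B →
        famCov A B ≥ c * corrBound (famW1 A B) (famW1 A A) (famW1 B B)) ∧
      (∀ f g : Cube n → ℝ, IncreasingBounded f → IncreasingBounded g → FunWeaklySimilar K f g →
        funCov f g ≥ c * corrBound (funW 1 f g) (funW 1 f f) (funW 1 g g))) := by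
  obtain ⟨c, hc, hcov⟩ := exists_mul_corrBound_le_of_weaklySimilar 1
  have hquarter : ∀ {X Y : ℝ}, 0 ≤ X → c * X ≤ Y → c / 4 * X ≤ Y := fun hX hY =>
    (mul_le_mul_of_nonneg_right (div_le_self hc.le (by norm_num)) hX).trans hY
  have hfam : ∀ (n : ℕ) (A B : Set (Cube n)), IsUpperSet A → IsUpperSet B → FamSimilar A B →
      c / 4 * corrBound (famW1 A B) (famW1 A A) (famW1 B B) ≤ famCov A B :=
    fun n A B hA hB hAB => hquarter (corrBound_nonneg (famW1_nonneg A B))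
      ((hcov n).1 A B hA hB hAB.weaklyEqualRatios)
  refine ⟨⟨c / 4, by positivity, fun n => ⟨hfam n, fun A B hA hB hA' hB' => ⟨?_, ?_⟩,
    fun f g hf hg hfg => hquarter (corrBound_nonneg (funW_one_nonneg hf.1 hg.1))
      ((hcov n).2 f g hf hg hfg.weaklyEqualRatios), fun f g hf hg hf' hg' => ?_⟩⟩,
    fun K _ => exists_mul_corrBound_le_of_weaklySimilar K⟩
  · rw [← corrBound_eq_sum_of_const hA' hB']
    exact hfam n A B hA hB (equalRatios_of_const hA' hB')
  · rw [← corrBound_eq_sum_of_const hA' hB', corrBound_eq_div_of_const hA' hB']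
    rfl
  · rw [← four_mul_corrBound_eq_of_funRegular hf.1 hg.1 hf' hg', ge_iff_le, ← mul_assoc,
      div_mul_cancel₀ c four_ne_zero]
    exact (hcov n).2 f g hf hg (equalRatios_of_const hf' hg').weaklyEqualRatios
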